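/- Let $(R,\mathfrak m)$ be a commutative noetherian local ring, and let $M\subset N$ be a pure-injective hull of the $R$-module $M$; that is, $N$ is pure-injective, $M$ is pure in $N$, and every submodule $X\subset N$ such that $X\cap M=0$ and $(X\oplus M)/X$ is pure in $N/X$ is zero. For an $R$-module $A$ let $\mathrm{Koatt}(A)$ be the set of prime ideals $\mathfrak p$ of $R$ with $\mathfrak p=\mathrm{Ann}_R(U)$ for some submodule $U\subset A$, let $H(A)=\bigcap_{n\ge 1}\mathfrak m^nA$, and call $A$ radical-full if $\mathfrak mA=A$. Then: (a) $\mathrm{Koatt}(N)=\mathrm{Koatt}(M)$. (b) $H(N)$ is radical-full and pure-injective. (c) $N/H(N)$ is (isomorphic to) a direct summand of a product of $R$-modules of finite length. -/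

import Mathlib

universe u v w

open scoped TensorProduct

section PureInjective

variable (R : Type u) [CommRing R]

/-- A linear map `f : A → B` is a pure monomorphism if `X ⊗ A → X ⊗ B` is injective for every
`R`-module `X`. (For `X = R` this says that `f` itself is injective.) -/
def IsPureMono {A B : Type w} [AddCommGroup A] [Module R A] [AddCommGroup B] [Module R B]
    (f : A →ₗ[R] B) : Prop :=
  ∀ (X : Type w) [AddCommGroup X] [Module R X], Function.Injective (f.lTensor X)

/-- `N` is pure-injective if every linear map into `N` extends along every pure monomorphism. -/
def IsPureInjective (N : Type w) [AddCommGroup N] [Module R N] : Prop :=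
  ∀ (A B : Type w) [AddCommGroup A] [Module R A] [AddCommGroup B] [Module R B]
    (f : A →ₗ[R] B) (g : A →ₗ[R] N), IsPureMono R f → ∃ h : B →ₗ[R] N, h ∘ₗ f = g

/-- A pure monomorphism `f : A → B` is pure-essential if `0` is the only submodule `X` of `B` with
`X ∩ A = 0` for which `(X ⊕ A) / X` is pure in `B / X`, that is, for which the
composite `A → B → B / X` is again a pure monomorphism. -/
def IsPureEssential {A B : Type w} [AddCommGroup A] [Module R A] [AddCommGroup B] [Module R B]
    (f : A →ₗ[R] B) : Prop :=
  IsPureMono R f ∧ ∀ X : Submodule R B, IsPureMono R (X.mkQ ∘ₗ f) → X = ⊥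

/-- The embedding `ι : M → N` is a pure-injective hull of `M`. -/
def IsPureInjectiveHull {M N : Type w} [AddCommGroup M] [Module R M] [AddCommGroup N] [Module R N]
    (ι : M →ₗ[R] N) : Prop :=
  IsPureEssential R ι ∧ IsPureInjective R N

/-- `Koatt(M)`: the prime ideals of `R` that are the annihilator of some submodule of `M`. -/
def coattachedPrimes (M : Type w) [AddCommGroup M] [Module R M] : Set (Ideal R) :=
  {p | p.IsPrime ∧ ∃ U : Submodule R M, p = Module.annihilator R U}

/-- `A` is a direct summand of `B` (up to isomorphism): there are linear maps `A → B → A` with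
composite the identity. -/
def IsDirectSummandOf (A B : Type w) [AddCommGroup A] [Module R A] [AddCommGroup B] [Module R B] :
    Prop :=
  ∃ (s : A →ₗ[R] B) (r : B →ₗ[R] A), r ∘ₗ s = LinearMap.id

end PureInjective

section Local

variable (R : Type u) [CommRing R] [IsLocalRing R]

/-- `H(N)`, the intersection of all `𝔪 ^ n N` (the term `n = 0` is `N` and adds nothing). -/
def radicalPowerInter (N : Type w) [AddCommGroup N] [Module R N] : Submodule R N :=
  ⨅ n : ℕ, (IsLocalRing.maximalIdeal R) ^ n • (⊤ : Submodule R N)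

/-- `A` is radical-full if `𝔪 A = A`. -/
def IsRadicalFull (A : Type w) [AddCommGroup A] [Module R A] : Prop :=
  IsLocalRing.maximalIdeal R • (⊤ : Submodule R A) = ⊤

end Local

/-! ### Injective modules and duals into them -/

section Baer

variable {R : Type*} [CommRing R] {E : Type*} [AddCommGroup E] [Module R E]

/-! Write `X* = Hom(X, E)` with `E` injective with simple socle over `R`. Then `E` cogenerates, so
`A → A**` is pure, and duals are pure-injective by tensor-hom adjunction. The engine is: for `J`
finitely generated, `J X*` is the set of forms vanishing on the `J`-torsion `X[J]`.

(a) Pure-essentiality embeds `N` in `M**` over `M`. If `𝔭 = Ann U` with `U ⊂ N` and `r` kills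
`M[𝔭]`, then `r M* ⊂ 𝔭 M*`, so `r` kills `U`; hence `Ann M[𝔭] = 𝔭`.

(b), (c) `N` is a summand of `X*` with `X = N*`, and both claims pass to summands. If `Γ` is the
`𝔪`-power torsion of `X`, the engine gives `H(X*) = (X/Γ)*` and `X*/H(X*) = Γ*`. The former is
radical-full since `X/Γ` has no `𝔪`-torsion; the latter is a summand of the product of the duals of
the finitely generated submodules of `Γ`, which have finite length. -/

lemma Module.Baer.of_retract {F : Type*} [AddCommGroup F] [Module R F] (hE : Module.Baer R E)
    (s : F →ₗ[R] E) (r : E →ₗ[R] F) (h : r ∘ₗ s = LinearMap.id) : Module.Baer R F := by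
  intro I g
  obtain ⟨g', hg'⟩ := hE I (s ∘ₗ g)
  refine ⟨r ∘ₗ g', fun x hx => ?_⟩
  rw [LinearMap.comp_apply, hg' x hx]
  exact LinearMap.congr_fun h _

lemma Module.Baer.exists_comp_eq_of_ker_le (hE : Module.Baer R E) {A B : Type*} [AddCommGroup A]
    [Module R A] [AddCommGroup B] [Module R B] (f : A →ₗ[R] B) (g : A →ₗ[R] E)
    (h : LinearMap.ker f ≤ LinearMap.ker g) : ∃ k : B →ₗ[R] E, k ∘ₗ f = g := by
  obtain ⟨k, hk⟩ := hE.extension_property ((LinearMap.ker f).liftQ f le_rfl)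
    (LinearMap.ker_eq_bot.1 (Submodule.ker_liftQ_eq_bot _ _ _ le_rfl)) ((LinearMap.ker f).liftQ g h)
  refine ⟨k, LinearMap.ext fun x => ?_⟩
  simpa using LinearMap.congr_fun hk ((LinearMap.ker f).mkQ x)

/-- A linear form that vanishes on the `J`-torsion lies in `J • Hom(X, E)`, for `E` injective and
`J` finitely generated. -/
lemma Module.Baer.mem_smul_top_of_torsionBySet_le_ker (hE : Module.Baer R E) {X : Type*}
    [AddCommGroup X] [Module R X] {J : Ideal R} (hJ : J.FG) (φ : X →ₗ[R] E)
    (hφ : Submodule.torsionBySet R X (J : Set R) ≤ LinearMap.ker φ) :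
    φ ∈ J • (⊤ : Submodule R (X →ₗ[R] E)) := by
  obtain ⟨n, a, rfl⟩ := Submodule.fg_iff_exists_fin_generating_family.1 hJ
  -- The map `x ↦ (a i • x)` has kernel `X[J]`, so `φ` factors through it.
  obtain ⟨ψ, rfl⟩ := hE.exists_comp_eq_of_ker_le
    (LinearMap.pi fun i => a i • (LinearMap.id : X →ₗ[R] X)) φ (by
      refine le_trans (fun x hx => ?_) hφ
      rw [← Ideal.span, ← Submodule.torsionBySet_eq_torsionBySet_span,
        Submodule.mem_torsionBySet_iff]
      rintro ⟨_, i, rfl⟩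
      simpa using congrFun hx i)
  have : ψ ∘ₗ (LinearMap.pi fun i => a i • (LinearMap.id : X →ₗ[R] X)) =
      ∑ i, a i • (ψ ∘ₗ LinearMap.single R (fun _ => X) i) := by
    ext x
    have hx := congrArg ψ (Finset.univ_sum_single (fun i => a i • x))
    rw [map_sum] at hx
    simp only [LinearMap.comp_apply, LinearMap.sum_apply, LinearMap.smul_apply,
      LinearMap.single_apply, ← map_smul, ← Pi.single_smul']
    exact hx.symm
  rw [this]
  exact Submodule.sum_mem _ fun i _ => Submodule.smul_mem_smul
    (Submodule.subset_span ⟨i, rfl⟩) trivial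

lemma torsionBySet_le_ker_of_mem_smul_top {X : Type*}
    [AddCommGroup X] [Module R X] {J : Ideal R} {φ : X →ₗ[R] E}
    (hφ : φ ∈ J • (⊤ : Submodule R (X →ₗ[R] E))) :
    Submodule.torsionBySet R X (J : Set R) ≤ LinearMap.ker φ := by
  intro x hx
  rw [Submodule.mem_torsionBySet_iff] at hx
  refine Submodule.smul_induction_on hφ (fun r hr ψ _ => ?_) (fun ψ χ hψ hχ => ?_)
  · simpa using congrArg ψ (hx ⟨r, hr⟩)
  · simpa using Submodule.add_mem (LinearMap.ker (LinearMap.applyₗ (R := R) (M₂ := E) x)) hψ hχ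

lemma baer_characterModule : Module.Baer R (CharacterModule R) := by
  rw [Module.Baer.iff_surjective]
  intro I
  rw [← rTensor_injective_iff_lcomp_surjective]
  exact Module.Flat.rTensor_preserves_injective_linearMap _ I.injective_subtype

open Filter in
/-- The dual of a module is a direct summand of the product of the duals of its finitely generated
submodules. -/
lemma Module.Baer.exists_retraction_pi_fg (hE : Module.Baer R E) {X : Type*} [AddCommGroup X]
    [Module R X] :
    ∃ (s : (X →ₗ[R] E) →ₗ[R] (∀ L : {L : Submodule R X // L.FG}, L.1 →ₗ[R] E))
      (r : (∀ L : {L : Submodule R X // L.FG}, L.1 →ₗ[R] E) →ₗ[R] (X →ₗ[R] E)),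
      r ∘ₗ s = LinearMap.id := by
  classical
  let I := {L : Submodule R X // L.FG}
  have : Nonempty I := ⟨⟨⊥, Submodule.fg_bot⟩⟩
  have : IsDirectedOrder I :=
    ⟨fun L L' => ⟨⟨L.1 ⊔ L'.1, L.2.sup L'.2⟩, le_sup_left, le_sup_right⟩⟩
  let F : Filter I := atTop
  -- A retraction `ρ` of constant germs acts as a linear limit along the directed set of finitely
  -- generated submodules.
  let c : E →ₗ[R] Germ F E :=
    { toFun := fun e => ((fun _ => e : I → E) : Germ F E)
      map_add' := fun _ _ => rfl
      map_smul' := fun _ _ => rfl }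
  obtain ⟨ρ, hρ⟩ := hE.extension_property c
    (fun _ _ h => (eventually_const.1 (Germ.coe_eq.1 h))) LinearMap.id
  have key (x : X) : ∀ᶠ L : I in F, x ∈ L.1 := by
    filter_upwards [eventually_ge_atTop (⟨R ∙ x, Submodule.fg_span_singleton x⟩ : I)] with L hL
    exact hL (Submodule.mem_span_singleton_self x)
  -- The value `0` is harmless: eventually `x ∈ L`, and only germs matter.
  let v (ψ : ∀ L : I, L.1 →ₗ[R] E) (x : X) (L : I) : E := if h : x ∈ L.1 then ψ L ⟨x, h⟩ else 0
  let r : (∀ L : I, L.1 →ₗ[R] E) →ₗ[R] (X →ₗ[R] E) := LinearMap.mk₂ R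
    (fun ψ x => ρ ((v ψ x : I → E) : Germ F E))
    (fun ψ ψ' x => by
      rw [← map_add, ← Germ.coe_add]
      congr 2
      ext L
      by_cases h : x ∈ L.1 <;> simp [v, h])
    (fun a ψ x => by
      rw [← map_smul, ← Germ.coe_smul]
      congr 2
      ext L
      by_cases h : x ∈ L.1 <;> simp [v, h])
    (fun ψ x y => by
      rw [← map_add, ← Germ.coe_add]
      congr 1
      refine Germ.coe_eq.2 ?_
      filter_upwards [key x, key y] with L hx hy
      simp [v, hx, hy, L.1.add_mem hx hy, ← map_add])
    (fun a ψ x => by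
      rw [← map_smul, ← Germ.coe_smul]
      congr 1
      refine Germ.coe_eq.2 ?_
      filter_upwards [key x] with L hx
      simp [v, hx, L.1.smul_mem a hx, ← map_smul])
  refine ⟨LinearMap.pi fun L => LinearMap.lcomp R E L.1.subtype, r, ?_⟩
  ext φ x
  refine Eq.trans (congrArg ρ ?_) (LinearMap.congr_fun hρ (φ x))
  refine Germ.coe_eq.2 ?_
  filter_upwards [key x] with L hx
  simp [v, hx]

end Baer

/-! ### The injective hull of the residue field -/

section ResidueHull

variable (R : Type*) [CommRing R] [IsLocalRing R]

local notation "𝔪" => IsLocalRing.maximalIdeal R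

/-- `E` is injective and its socle is simple, generated by `e`; the injective hull of the residue
field is such a module. -/
structure IsInjectiveWithSimpleSocle (E : Type*) [AddCommGroup E] [Module R E] (e : E) : Prop where
  baer : Module.Baer R E
  ne_zero : e ≠ 0
  smul_eq_zero : ∀ r ∈ 𝔪, r • e = 0
  mem_span : ∀ x : E, (∀ r ∈ 𝔪, r • x = 0) → x ∈ R ∙ e

variable {R}

lemma exists_characterModule_socle : ∃ e : CharacterModule R, e ≠ 0 ∧ ∀ r ∈ 𝔪, r • e = 0 := by
  have h1 : Submodule.Quotient.mk (p := 𝔪) (1 : R) ≠ 0 := by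
    rw [Ne, Submodule.Quotient.mk_eq_zero]
    exact fun h => (Ideal.ne_top_iff_one _).1 (IsLocalRing.maximalIdeal.isMaximal R).ne_top h
  obtain ⟨c, hc⟩ := CharacterModule.exists_character_apply_ne_zero_of_ne_zero h1
  refine ⟨CharacterModule.dual (Submodule.mkQ 𝔪) c, fun h => hc ?_, fun r hr => ?_⟩
  · exact DFunLike.congr_fun h (1 : R)
  · ext x
    have : Submodule.mkQ 𝔪 (r • x) = 0 := by
      rw [Submodule.mkQ_apply, Submodule.Quotient.mk_eq_zero, smul_eq_mul]
      exact Ideal.mul_mem_right _ _ hr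
    change c (Submodule.mkQ 𝔪 (r • x)) = 0
    rw [this, map_zero]

/-- Any element `e` of an injective module lies in an injective submodule whose socle is contained
in `R ∙ e`, namely in a maximal one among the submodules with such a socle. -/
lemma Module.Baer.exists_injective_submodule {I : Type*} [AddCommGroup I] [Module R I]
    (hI : Module.Baer R I) (e : I) :
    ∃ E : Submodule R I, e ∈ E ∧ (∀ x ∈ E, (∀ r ∈ 𝔪, r • x = 0) → x ∈ R ∙ e) ∧
      Module.Baer R E := by
  let S : Set (Submodule R I) :=
    {E | e ∈ E ∧ ∀ x ∈ E, (∀ r ∈ 𝔪, r • x = 0) → x ∈ R ∙ e}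
  obtain ⟨E, -, hE⟩ := zorn_le_nonempty₀ S (fun c hc hchain y hy => by
    refine ⟨sSup c, ⟨le_sSup hy (hc hy).1, fun x hx => ?_⟩, fun z hz => le_sSup hz⟩
    obtain ⟨z, hz, hxz⟩ := (Submodule.mem_sSup_of_directed ⟨y, hy⟩ hchain.directedOn).1 hx
    exact (hc hz).2 x hxz) (R ∙ e) ⟨Submodule.mem_span_singleton_self e, fun x hx _ => hx⟩
  refine ⟨E, hE.prop.1, hE.prop.2, ?_⟩
  -- With `C` maximal among submodules meeting `E` trivially, `E → I/C` is essential. So the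
  -- extension `h : I/C → I` of the inclusion is injective and adds no socle; maximality of `E`
  -- forces its image into `E`.
  obtain ⟨C, -, hC⟩ := zorn_le_nonempty₀ {C : Submodule R I | ∀ x ∈ E, x ∈ C → x = 0}
    (fun c hc hchain y hy => by
      refine ⟨sSup c, fun x hxE hx => ?_, fun z hz => le_sSup hz⟩
      obtain ⟨z, hz, hxz⟩ := (Submodule.mem_sSup_of_directed ⟨y, hy⟩ hchain.directedOn).1 hx
      exact hc hz x hxE hxz) ⊥ (fun x _ hx => (Submodule.mem_bot R).1 hx)
  obtain ⟨h, hh⟩ := hI.extension_property (C.mkQ ∘ₗ E.subtype) (by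
    rw [injective_iff_map_eq_zero]
    intro x hx
    exact Subtype.ext (hC.prop x x.2 ((Submodule.Quotient.mk_eq_zero _).1 hx))) E.subtype
  have hh' (x : I) (hx : x ∈ E) : h (C.mkQ x) = x := LinearMap.congr_fun hh ⟨x, hx⟩
  have hinj (y : I) (hy : h (C.mkQ y) = 0) : y ∈ C := by
    have hle : C ≤ LinearMap.ker (h ∘ₗ C.mkQ) := fun c hc => by
      simp [(Submodule.Quotient.mk_eq_zero C).2 hc]
    refine hC.le_of_ge (fun x hx hx' => ?_) hle hy
    rw [← hh' x hx]
    exact hx'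
  have hrange : ∀ y : I, h (C.mkQ y) ∈ E := by
    have hle : E ≤ LinearMap.range h := fun x hx => ⟨C.mkQ x, hh' x hx⟩
    suffices LinearMap.range h ∈ S from
      fun y => hE.le_of_ge this hle (LinearMap.mem_range_self h _)
    refine ⟨hle hE.prop.1, ?_⟩
    rintro _ ⟨q, rfl⟩ hq
    obtain ⟨y, rfl⟩ := C.mkQ_surjective q
    suffices h (C.mkQ y) ∈ E from hE.prop.2 _ this hq
    by_contra hyE
    have hyC : y ∉ C := fun hy => hyE (by
      rw [Submodule.mkQ_apply, (Submodule.Quotient.mk_eq_zero C).2 hy, map_zero]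
      exact E.zero_mem)
    have : ¬ ∀ x ∈ E, x ∈ C ⊔ R ∙ y → x = 0 := fun hs =>
      hyC (hC.le_of_ge hs le_sup_left (Submodule.mem_sup_right
        (Submodule.mem_span_singleton_self y)))
    push Not at this
    obtain ⟨z, hzE, hz, hz0⟩ := this
    obtain ⟨c, hc, w, hw, rfl⟩ := Submodule.mem_sup.1 hz
    obtain ⟨r, rfl⟩ := Submodule.mem_span_singleton.1 hw
    have hr : IsUnit r := by
      by_contra hr
      have : r • y ∈ C := hinj _ (by
        rw [map_smul, map_smul]
        exact hq r ((IsLocalRing.mem_maximalIdeal r).2 hr))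
      exact hz0 (hC.prop _ hzE (C.add_mem hc this))
    refine hyE ((Submodule.smul_mem_iff_of_isUnit E hr).1 ?_)
    have h1 := hh' _ hzE
    rw [map_add, Submodule.mkQ_apply, (Submodule.Quotient.mk_eq_zero C).2 hc, zero_add, map_smul,
      map_smul] at h1
    rw [h1]
    exact hzE
  exact hI.of_retract E.subtype ((h ∘ₗ C.mkQ).codRestrict E hrange)
    (LinearMap.ext fun x => Subtype.ext (hh' x x.2))

lemma exists_isInjectiveWithSimpleSocle (R : Type u) [CommRing R] [IsLocalRing R] :
    ∃ (E : Type u) (_ : AddCommGroup E) (_ : Module R E) (e : E),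
      IsInjectiveWithSimpleSocle R E e := by
  obtain ⟨e, he0, he⟩ := exists_characterModule_socle (R := R)
  obtain ⟨E, heE, hE, hb⟩ := baer_characterModule.exists_injective_submodule e
  refine ⟨E, inferInstance, inferInstance, ⟨e, heE⟩, hb, fun h => he0 (congrArg Subtype.val h),
    fun r hr => Subtype.ext (he r hr), fun x hx => ?_⟩
  obtain ⟨r, hr⟩ := Submodule.mem_span_singleton.1 (hE x x.2 fun r hr => congrArg Subtype.val (hx r hr))
  exact Submodule.mem_span_singleton.2 ⟨r, Subtype.ext hr⟩

namespace IsInjectiveWithSimpleSocle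

variable {E : Type*} [AddCommGroup E] [Module R E] {e : E}

/-- The annihilator of `a` lies in `𝔪`, which kills `e`, so `r • a ↦ r • e` is well defined and
extends. -/
lemma exists_apply_ne_zero (hE : IsInjectiveWithSimpleSocle R E e) {A : Type*}
    [AddCommGroup A] [Module R A] {a : A} (ha : a ≠ 0) :
    ∃ φ : A →ₗ[R] E, φ a ≠ 0 := by
  obtain ⟨φ, hφ⟩ := hE.baer.exists_comp_eq_of_ker_le (LinearMap.toSpanSingleton R A a)
    (LinearMap.toSpanSingleton R E e) (fun r hr => by
      refine hE.smul_eq_zero r ((IsLocalRing.mem_maximalIdeal r).2 fun hu => ha ?_)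
      exact (hu.smul_eq_zero).1 hr)
  refine ⟨φ, fun h => hE.ne_zero ?_⟩
  have := LinearMap.congr_fun hφ 1
  simpa [h] using this.symm

lemma isNoetherian_and_isArtinian_span (hE : IsInjectiveWithSimpleSocle R E e) :
    IsNoetherian R (R ∙ e) ∧ IsArtinian R (R ∙ e) := by
  let f : (R ⧸ 𝔪) →ₗ[R] E := Submodule.liftQ 𝔪 (LinearMap.toSpanSingleton R E e)
    (fun r hr => hE.smul_eq_zero r hr)
  have hf : LinearMap.range f = R ∙ e := by
    exact (Submodule.range_liftQ _ _ _).trans (LinearMap.range_toSpanSingleton e)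
  have : IsSimpleModule R (R ⧸ 𝔪) :=
    isSimpleModule_iff_isCoatom.2 (IsLocalRing.maximalIdeal.isMaximal R).out
  rw [← hf]
  exact ⟨inferInstance, inferInstance⟩

variable [IsNoetherianRing R]

/-- Multiplication by generators of `𝔪` sends `E[𝔪ⁿ⁺¹]` to a finite power of `E[𝔪ⁿ]`, with kernel
inside the simple socle. -/
lemma isNoetherian_and_isArtinian_torsionBySet (hE : IsInjectiveWithSimpleSocle R E e) (n : ℕ) :
    IsNoetherian R (Submodule.torsionBySet R E ((𝔪 ^ n : Ideal R) : Set R)) ∧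
      IsArtinian R (Submodule.torsionBySet R E ((𝔪 ^ n : Ideal R) : Set R)) := by
  induction n with
  | zero =>
    have : Submodule.torsionBySet R E ((𝔪 ^ 0 : Ideal R) : Set R) = ⊥ := by
      rw [pow_zero, Ideal.one_eq_top]
      exact Submodule.torsionBySet_univ
    rw [this]
    exact ⟨inferInstance, inferInstance⟩
  | succ n ih =>
    obtain ⟨_, _⟩ := ih
    obtain ⟨_, _⟩ := hE.isNoetherian_and_isArtinian_span
    obtain ⟨k, a, ha⟩ := Submodule.fg_iff_exists_fin_generating_family.1
      (IsNoetherian.noetherian (R := R) 𝔪)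
    have ham (i) : a i ∈ 𝔪 := ha ▸ Submodule.subset_span ⟨i, rfl⟩
    let g : Submodule.torsionBySet R E ((𝔪 ^ (n + 1) : Ideal R) : Set R) →ₗ[R]
        (Fin k → Submodule.torsionBySet R E ((𝔪 ^ n : Ideal R) : Set R)) :=
      LinearMap.pi fun i => LinearMap.codRestrict _
        (a i • Submodule.subtype _) (fun x => by
          rw [Submodule.mem_torsionBySet_iff]
          rintro ⟨b, hb⟩
          have := (Submodule.mem_torsionBySet_iff _ _).1 x.2
            ⟨b * a i, by rw [pow_succ]; exact Ideal.mul_mem_mul hb (ham i)⟩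
          simpa [mul_smul] using this)
    have hker (x) (hx : x ∈ LinearMap.ker g) : (x : E) ∈ R ∙ e := by
      refine hE.mem_span _ fun r hr => ?_
      have : 𝔪 ≤ LinearMap.ker (LinearMap.toSpanSingleton R E x) := by
        refine ha.ge.trans (Submodule.span_le.2 ?_)
        rintro _ ⟨i, rfl⟩
        exact congrArg Subtype.val (congrFun hx i)
      exact this hr
    let j : LinearMap.ker g →ₗ[R] (R ∙ e) := LinearMap.codRestrict _
      (Submodule.subtype _ ∘ₗ Submodule.subtype _) (fun x => hker x.1 x.2)
    have hj : Function.Injective j := fun x y h =>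
      Subtype.ext (Subtype.ext (congrArg (fun z : R ∙ e => (z : E)) h))
    have := isNoetherian_of_injective j hj
    have := isArtinian_of_injective j hj
    have hex : LinearMap.range (LinearMap.ker g).subtype = LinearMap.ker g :=
      Submodule.range_subtype _
    exact ⟨isNoetherian_of_range_eq_ker _ g hex, isArtinian_of_range_eq_ker _ g hex⟩

/-- The dual of a finitely generated module which is annihilated by a power of the maximal ideal has
finite length. -/
lemma isFiniteLength_hom (hE : IsInjectiveWithSimpleSocle R E e) {L : Type*}
    [AddCommGroup L] [Module R L] [Module.Finite R L] {n : ℕ}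
    (hL : ∀ x : L, ∀ r ∈ 𝔪 ^ n, r • x = 0) : IsFiniteLength R (L →ₗ[R] E) := by
  obtain ⟨_, _⟩ := hE.isNoetherian_and_isArtinian_torsionBySet n
  obtain ⟨k, s, hs⟩ := Module.Finite.exists_fin (R := R) (M := L)
  let g : (L →ₗ[R] E) →ₗ[R]
      (Fin k → Submodule.torsionBySet R E ((𝔪 ^ n : Ideal R) : Set R)) :=
    LinearMap.pi fun i => LinearMap.codRestrict _ (LinearMap.applyₗ (s i)) (fun φ => by
      rw [Submodule.mem_torsionBySet_iff]
      rintro ⟨b, hb⟩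
      simpa using congrArg φ (hL (s i) b hb))
  have hg : Function.Injective g := fun φ ψ h =>
    LinearMap.ext_on_range hs fun i => congrArg Subtype.val (congrFun h i)
  exact isFiniteLength_iff_isNoetherian_isArtinian.2
    ⟨isNoetherian_of_injective g hg, isArtinian_of_injective g hg⟩

end IsInjectiveWithSimpleSocle

end ResidueHull

/-! ### Stability under direct summands -/

section Retract

variable {R : Type u} [CommRing R] {A B C : Type w} [AddCommGroup A] [Module R A] [AddCommGroup B]
  [Module R B] [AddCommGroup C] [Module R C]

lemma IsDirectSummandOf.trans (h : IsDirectSummandOf R A B) (h' : IsDirectSummandOf R B C) :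
    IsDirectSummandOf R A C := by
  obtain ⟨s, r, h⟩ := h
  obtain ⟨s', r', h'⟩ := h'
  exact ⟨s' ∘ₗ s, r ∘ₗ r', LinearMap.ext fun x =>
    (congrArg r (LinearMap.congr_fun h' (s x))).trans (LinearMap.congr_fun h x)⟩

lemma LinearEquiv.isDirectSummandOf (f : A ≃ₗ[R] B) : IsDirectSummandOf R A B :=
  ⟨f, f.symm, LinearMap.ext fun x => f.symm_apply_apply x⟩

lemma IsDirectSummandOf.isPureInjective (h : IsDirectSummandOf R A B)
    (hB : IsPureInjective R B) : IsPureInjective R A := by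
  obtain ⟨s, r, h⟩ := h
  intro X Y _ _ _ _ f g hf
  obtain ⟨k, hk⟩ := hB X Y f (s ∘ₗ g) hf
  refine ⟨r ∘ₗ k, ?_⟩
  rw [LinearMap.comp_assoc, hk, ← LinearMap.comp_assoc, h, LinearMap.id_comp]

variable [IsLocalRing R]

lemma IsRadicalFull.of_surjective (hA : IsRadicalFull R A) {f : A →ₗ[R] B}
    (hf : Function.Surjective f) : IsRadicalFull R B := by
  unfold IsRadicalFull at *
  have := congrArg (Submodule.map f) hA
  rwa [Submodule.map_smul'', Submodule.map_top, LinearMap.range_eq_top.2 hf] at this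

lemma radicalPowerInter_le_comap (f : A →ₗ[R] B) :
    radicalPowerInter R A ≤ (radicalPowerInter R B).comap f := by
  intro x hx
  simp only [radicalPowerInter, Submodule.mem_comap, Submodule.mem_iInf] at hx ⊢
  intro n
  have := Submodule.mem_map_of_mem (f := f) (hx n)
  rw [Submodule.map_smul''] at this
  exact Submodule.smul_mono le_rfl le_top this

lemma IsDirectSummandOf.radicalPowerInter (h : IsDirectSummandOf R A B) :
    IsDirectSummandOf R (radicalPowerInter R A) (radicalPowerInter R B) := by
  obtain ⟨s, r, h⟩ := h
  exact ⟨s.restrict (radicalPowerInter_le_comap s), r.restrict (radicalPowerInter_le_comap r),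
    LinearMap.ext fun x => Subtype.ext (LinearMap.congr_fun h x)⟩

lemma IsDirectSummandOf.quotient_radicalPowerInter (h : IsDirectSummandOf R A B) :
    IsDirectSummandOf R (A ⧸ _root_.radicalPowerInter R A) (B ⧸ _root_.radicalPowerInter R B) := by
  obtain ⟨s, r, h⟩ := h
  refine ⟨Submodule.mapQ _ _ s (radicalPowerInter_le_comap s),
    Submodule.mapQ _ _ r (radicalPowerInter_le_comap r), Submodule.linearMap_qext _ ?_⟩
  ext x
  exact congrArg (Submodule.mkQ _) (LinearMap.congr_fun h x)

end Retract

/-! ### Pure monomorphisms -/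

section Pure

variable {R : Type u} [CommRing R]

lemma IsPureMono.injective {A B : Type (max u v)} [AddCommGroup A] [Module R A] [AddCommGroup B]
    [Module R B] {f : A →ₗ[R] B} (h : IsPureMono.{u, max u v} R f) : Function.Injective f := by
  have : Module.FaithfullyFlat R (ULift.{v} R) :=
    Module.FaithfullyFlat.of_linearEquiv R _ ULift.moduleEquiv
  exact (Module.FaithfullyFlat.lTensor_injective_iff_injective R (ULift.{v} R) f).1 (h _)

lemma IsPureMono.of_comp {A B C : Type w} [AddCommGroup A] [Module R A] [AddCommGroup B]
    [Module R B] [AddCommGroup C] [Module R C] {f : A →ₗ[R] B} {g : B →ₗ[R] C}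
    (h : IsPureMono R (g ∘ₗ f)) : IsPureMono R f := by
  intro X _ _
  have := h X
  rw [LinearMap.lTensor_comp, LinearMap.coe_comp] at this
  exact this.of_comp

/-- A map out of the target of a pure-essential monomorphism is injective if its restriction to the
source is a pure monomorphism. -/
lemma IsPureEssential.injective_of_isPureMono_comp {A B C : Type w} [AddCommGroup A] [Module R A]
    [AddCommGroup B] [Module R B] [AddCommGroup C] [Module R C] {f : A →ₗ[R] B}
    (hf : IsPureEssential R f) {g : B →ₗ[R] C} (h : IsPureMono R (g ∘ₗ f)) :
    Function.Injective g := by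
  refine LinearMap.ker_eq_bot.1 (hf.2 _ (IsPureMono.of_comp (g := (LinearMap.ker g).liftQ g le_rfl)
    ?_))
  rwa [← LinearMap.comp_assoc, Submodule.liftQ_mkQ]

lemma coattachedPrimes_subset_of_injective {A B : Type w} [AddCommGroup A] [Module R A]
    [AddCommGroup B] [Module R B] {f : A →ₗ[R] B} (hf : Function.Injective f) :
    coattachedPrimes R A ⊆ coattachedPrimes R B := by
  rintro p ⟨hp, U, rfl⟩
  exact ⟨hp, U.map f, (U.equivMapOfInjective f hf).annihilator_eq⟩

end Pure

/-! ### Biduals and coattached primes -/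

section Dual

variable {R : Type u} [CommRing R] {E : Type u} [AddCommGroup E] [Module R E]

lemma Module.Baer.isPureInjective_hom (hE : Module.Baer R E) (X : Type (max u v)) [AddCommGroup X]
    [Module R X] : IsPureInjective.{u, max u v} R (X →ₗ[R] E) := by
  intro A B _ _ _ _ f g hf
  obtain ⟨h, hh⟩ := hE.extension_property (f.lTensor X) (hf X) (TensorProduct.lift g.flip)
  refine ⟨(TensorProduct.curry h).flip, LinearMap.ext fun a => LinearMap.ext fun x => ?_⟩
  simpa using LinearMap.congr_fun hh (x ⊗ₜ a)

variable [IsLocalRing R] {e : E}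

/-- Every form on `X ⊗ A` extends to `X ⊗ A**` by currying, and forms separate points. -/
lemma IsInjectiveWithSimpleSocle.isPureMono_applyₗ (hE : IsInjectiveWithSimpleSocle R E e)
    (A : Type (max u v)) [AddCommGroup A] [Module R A] :
    IsPureMono.{u, max u v} R
      (LinearMap.applyₗ : A →ₗ[R] (A →ₗ[R] E) →ₗ[R] E) := by
  intro X _ _
  rw [injective_iff_map_eq_zero]
  intro t ht
  by_contra ht0
  obtain ⟨φ, hφ⟩ := hE.exists_apply_ne_zero ht0
  let ψ : X ⊗[R] ((A →ₗ[R] E) →ₗ[R] E) →ₗ[R] E :=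
    TensorProduct.lift (LinearMap.applyₗ ∘ₗ TensorProduct.curry φ)
  have hψ : ψ ∘ₗ LinearMap.lTensor X (LinearMap.applyₗ : A →ₗ[R] (A →ₗ[R] E) →ₗ[R] E) = φ := by
    ext x a
    simp [ψ]
  apply hφ
  rw [← hψ, LinearMap.comp_apply, ht, map_zero]

lemma IsInjectiveWithSimpleSocle.isDirectSummandOf_bidual (hE : IsInjectiveWithSimpleSocle R E e)
    {A : Type (max u v)} [AddCommGroup A] [Module R A] (hA : IsPureInjective.{u, max u v} R A) :
    IsDirectSummandOf.{u, max u v} R A ((A →ₗ[R] E) →ₗ[R] E) := by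
  obtain ⟨r, hr⟩ := hA _ _ _ LinearMap.id (hE.isPureMono_applyₗ A)
  exact ⟨_, r, hr⟩

lemma coattachedPrimes_subset_of_isPureEssential [IsNoetherianRing R] {M N : Type (max u v)}
    [AddCommGroup M] [Module R M] [AddCommGroup N] [Module R N] {ι : M →ₗ[R] N}
    (hι : IsPureEssential.{u, max u v} R ι) :
    coattachedPrimes.{u, max u v} R N ⊆ coattachedPrimes.{u, max u v} R M := by
  obtain ⟨E, _, _, e, hE⟩ := exists_isInjectiveWithSimpleSocle R
  obtain ⟨j, hj⟩ := hE.baer.isPureInjective_hom.{u, v} (M →ₗ[R] E) _ _ ι LinearMap.applyₗ hι.1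
  have hinj : Function.Injective j :=
    hι.injective_of_isPureMono_comp (hj ▸ hE.isPureMono_applyₗ.{u, v} M)
  rintro p ⟨hp, U, hU⟩
  refine ⟨hp, Submodule.torsionBySet R M (p : Set R), le_antisymm (fun r hr => ?_) fun r hr => ?_⟩
  · rw [Submodule.mem_annihilator]
    exact fun x hx => (Submodule.mem_torsionBySet_iff _ _).1 hx ⟨r, hr⟩
  · rw [hU, Submodule.mem_annihilator]
    intro x hx
    refine hinj (LinearMap.ext fun φ => ?_)
    have hφ : r • φ ∈ p • (⊤ : Submodule R (M →ₗ[R] E)) :=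
      hE.baer.mem_smul_top_of_torsionBySet_le_ker (IsNoetherian.noetherian p) _ fun y hy => by
        rw [LinearMap.mem_ker, LinearMap.smul_apply, ← map_smul,
          Submodule.mem_annihilator.1 hr y hy, map_zero]
    rw [map_smul, LinearMap.smul_apply, ← map_smul, map_zero, LinearMap.zero_apply]
    have hx' : ∀ a ∈ p, a • x = 0 := fun a ha => Submodule.mem_annihilator.1 (hU.le ha) x hx
    refine Submodule.smul_induction_on hφ (fun a ha ψ _ => ?_) (fun ψ χ hψ hχ => ?_)
    · rw [map_smul, ← LinearMap.smul_apply, ← map_smul, hx' a ha, map_zero, LinearMap.zero_apply]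
    · rw [map_add, hψ, hχ, add_zero]

end Dual

/-! ### Torsion for powers of the maximal ideal -/

section PowerTorsion

variable (R : Type*) [CommRing R] [IsLocalRing R] (X : Type*) [AddCommGroup X] [Module R X]

local notation "𝔪" => IsLocalRing.maximalIdeal R

/-- The elements annihilated by some power of the maximal ideal. -/
def maximalPowerTorsion : Submodule R X :=
  ⨆ n : ℕ, Submodule.torsionBySet R X ((𝔪 ^ n : Ideal R) : Set R)

variable {R X}

lemma mem_maximalPowerTorsion {x : X} :
    x ∈ maximalPowerTorsion R X ↔ ∃ n : ℕ, ∀ r ∈ 𝔪 ^ n, r • x = 0 := by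
  rw [maximalPowerTorsion, Submodule.mem_iSup_of_directed _
    (Monotone.directed_le fun i j h => Submodule.torsionBySet_le_torsionBySet_pow i j h 𝔪)]
  simp [Submodule.mem_torsionBySet_iff]

lemma exists_pow_smul_eq_zero_of_fg_le_maximalPowerTorsion {L : Submodule R X} (hL : L.FG)
    (h : L ≤ maximalPowerTorsion R X) : ∃ n : ℕ, ∀ x ∈ L, ∀ r ∈ 𝔪 ^ n, r • x = 0 := by
  obtain ⟨_, ⟨n, rfl⟩, hn⟩ := (Submodule.fg_iff_compact L).1 hL
    (Set.range fun n : ℕ => Submodule.torsionBySet R X ((𝔪 ^ n : Ideal R) : Set R)) _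
    (Set.range_nonempty _) (directedOn_range.2 (Monotone.directed_le fun i j h =>
      Submodule.torsionBySet_le_torsionBySet_pow i j h 𝔪)) isLUB_iSup h
  exact ⟨n, fun x hx r hr => (Submodule.mem_torsionBySet_iff _ _).1 (hn hx) ⟨r, hr⟩⟩

variable [IsNoetherianRing R]

/-- If `𝔪 x` is power torsion, then, being finitely generated, it is killed by a single `𝔪ⁿ`, so
`𝔪ⁿ⁺¹` kills `x`. -/
lemma torsionBySet_quotient_maximalPowerTorsion :
    Submodule.torsionBySet R (X ⧸ maximalPowerTorsion R X) (𝔪 : Set R) = ⊥ := by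
  rw [eq_bot_iff]
  intro y hy
  obtain ⟨x, rfl⟩ := Submodule.mkQ_surjective _ y
  rw [Submodule.mem_torsionBySet_iff] at hy
  have hle : Submodule.map (LinearMap.toSpanSingleton R X x) 𝔪 ≤ maximalPowerTorsion R X := by
    rintro _ ⟨r, hr, rfl⟩
    exact (Submodule.Quotient.mk_eq_zero _).1 (hy ⟨r, hr⟩)
  obtain ⟨n, hn⟩ := exists_pow_smul_eq_zero_of_fg_le_maximalPowerTorsion
    ((IsNoetherian.noetherian (R := R) 𝔪).map _) hle
  rw [Submodule.mem_bot, Submodule.mkQ_apply, Submodule.Quotient.mk_eq_zero,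
    mem_maximalPowerTorsion]
  refine ⟨n + 1, fun r hr => ?_⟩
  have : 𝔪 ^ (n + 1) ≤ LinearMap.ker (LinearMap.toSpanSingleton R X x) := by
    rw [pow_succ, Ideal.mul_le]
    intro a ha b hb
    rw [LinearMap.mem_ker, LinearMap.toSpanSingleton_apply, mul_smul]
    exact hn _ ⟨b, hb, rfl⟩ a ha
  exact this hr

end PowerTorsion

/-! ### `H` of a dual module -/

section DualRadicalPowerInter

variable {R : Type u} [CommRing R] [IsLocalRing R] [IsNoetherianRing R] {E : Type u}
  [AddCommGroup E] [Module R E] {e : E} (X : Type (max u v)) [AddCommGroup X] [Module R X]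

lemma Module.Baer.mem_radicalPowerInter_hom_iff (hE : Module.Baer R E) (φ : X →ₗ[R] E) :
    φ ∈ radicalPowerInter.{u, max u v} R (X →ₗ[R] E) ↔
      maximalPowerTorsion R X ≤ LinearMap.ker φ := by
  rw [radicalPowerInter, Submodule.mem_iInf, maximalPowerTorsion, iSup_le_iff]
  exact forall_congr' fun n => ⟨torsionBySet_le_ker_of_mem_smul_top,
    hE.mem_smul_top_of_torsionBySet_le_ker (IsNoetherian.noetherian _) φ⟩

/-- The intersection of the `𝔪 ^ n Hom(X, E)` is the dual of `X` modulo its `𝔪`-power torsion. -/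
noncomputable def Module.Baer.homQuotientEquivRadicalPowerInter (hE : Module.Baer R E) :
    ((X ⧸ maximalPowerTorsion R X) →ₗ[R] E) ≃ₗ[R]
      radicalPowerInter.{u, max u v} R (X →ₗ[R] E) :=
  (LinearEquiv.ofInjective (LinearMap.lcomp R E (maximalPowerTorsion R X).mkQ)
    (LinearMap.lcomp_injective_of_surjective _ (Submodule.mkQ_surjective _))).trans
  (LinearEquiv.ofEq _ _ (by
    ext φ
    rw [hE.mem_radicalPowerInter_hom_iff.{u, v} X]
    constructor
    · rintro ⟨ψ, rfl⟩ x hx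
      simp [(Submodule.Quotient.mk_eq_zero _).2 hx]
    · exact fun h => ⟨(maximalPowerTorsion R X).liftQ φ h, Submodule.liftQ_mkQ _ φ h⟩))

lemma Module.Baer.isRadicalFull_radicalPowerInter_hom (hE : Module.Baer R E) :
    IsRadicalFull.{u, max u v} R (radicalPowerInter.{u, max u v} R (X →ₗ[R] E)) := by
  refine IsRadicalFull.of_surjective ?_ (hE.homQuotientEquivRadicalPowerInter.{u, v} X).surjective
  refine eq_top_iff.2 fun φ _ => hE.mem_smul_top_of_torsionBySet_le_ker
    (IsNoetherian.noetherian _) φ ?_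
  rw [torsionBySet_quotient_maximalPowerTorsion]
  exact bot_le

/-- `Hom(X, E)` modulo the intersection of the `𝔪 ^ n Hom(X, E)` is the dual of the `𝔪`-power
torsion of `X`. -/
noncomputable def Module.Baer.quotientRadicalPowerInterEquiv (hE : Module.Baer R E) :
    ((X →ₗ[R] E) ⧸ radicalPowerInter.{u, max u v} R (X →ₗ[R] E)) ≃ₗ[R]
      (maximalPowerTorsion R X →ₗ[R] E) :=
  (Submodule.quotEquivOfEq _ _ (by
    ext φ
    rw [hE.mem_radicalPowerInter_hom_iff.{u, v} X, LinearMap.mem_ker, LinearMap.ext_iff]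
    exact ⟨fun h x => h x.2, fun h x hx => h ⟨x, hx⟩⟩)).trans
  (LinearMap.quotKerEquivOfSurjective
    (LinearMap.lcomp R E (maximalPowerTorsion R X).subtype)
    fun φ => hE.extension_property _ (Submodule.injective_subtype _) φ)

lemma IsInjectiveWithSimpleSocle.exists_isDirectSummandOf_pi_isFiniteLength
    (hE : IsInjectiveWithSimpleSocle R E e) :
    ∃ (I : Type (max u v)) (Y : I → ModuleCat.{max u v} R), (∀ i, IsFiniteLength R (Y i)) ∧
      IsDirectSummandOf.{u, max u v} R (maximalPowerTorsion R X →ₗ[R] E) (∀ i, Y i) := by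
  refine ⟨{L : Submodule R (maximalPowerTorsion R X) // L.FG},
    fun L => ModuleCat.of R (L.1 →ₗ[R] E), fun L => ?_, hE.baer.exists_retraction_pi_fg⟩
  have : Module.Finite R L.1 := Module.Finite.iff_fg.2 L.2
  obtain ⟨n, hn⟩ := exists_pow_smul_eq_zero_of_fg_le_maximalPowerTorsion
    (L.2.map (maximalPowerTorsion R X).subtype) (Submodule.map_subtype_le _ _)
  exact hE.isFiniteLength_hom (n := n) fun x r hr =>
    Subtype.ext (Subtype.ext (hn _ ⟨x.1, x.2, rfl⟩ r hr))

end DualRadicalPowerInter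

/-! ### The theorem -/

theorem lemma1p5 {R : Type u} [CommRing R] [IsNoetherianRing R] [IsLocalRing R]
    {M N : Type (max u v)} [AddCommGroup M] [Module R M] [AddCommGroup N] [Module R N]
    (ι : M →ₗ[R] N) (hι : IsPureInjectiveHull R ι) :
    coattachedPrimes R N = coattachedPrimes R M ∧
    (IsRadicalFull R (radicalPowerInter R N) ∧ IsPureInjective R (radicalPowerInter R N)) ∧
    ∃ (I : Type (max u v)) (Y : I → ModuleCat.{max u v} R),
      (∀ i, IsFiniteLength R (Y i)) ∧
      IsDirectSummandOf R (N ⧸ radicalPowerInter R N) (∀ i, Y i) := by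
  obtain ⟨E, _, _, e, hE⟩ := exists_isInjectiveWithSimpleSocle R
  have hN := hE.isDirectSummandOf_bidual.{u, v} hι.2
  refine ⟨(coattachedPrimes_subset_of_isPureEssential.{u, v} hι.1).antisymm
    (coattachedPrimes_subset_of_injective hι.1.1.injective), ⟨?_, ?_⟩, ?_⟩
  · obtain ⟨s, r, h⟩ := hN.radicalPowerInter
    exact (hE.baer.isRadicalFull_radicalPowerInter_hom.{u, v} _).of_surjective
      fun x => ⟨s x, LinearMap.congr_fun h x⟩
  · exact (hN.radicalPowerInter.trans
      (hE.baer.homQuotientEquivRadicalPowerInter.{u, v} _).symm.isDirectSummandOf).isPureInjective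
      (hE.baer.isPureInjective_hom.{u, v} _)
  · obtain ⟨I, Y, hY, h⟩ := hE.exists_isDirectSummandOf_pi_isFiniteLength.{u, v} (N →ₗ[R] E)
    exact ⟨I, Y, hY, hN.quotient_radicalPowerInter.trans
      ((hE.baer.quotientRadicalPowerInterEquiv.{u, v} _).isDirectSummandOf.trans h)⟩
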